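/- Let $1\le p<\infty$, let $(X,\mathcal B,\mu)$ be a $\sigma$-finite measure space, and let $f:X\to X$ be a bijection such that $f$ and $f^{-1}$ are measurable, $f$ is non-singular (for $B\in\mathcal B$, $\mu(f^{-1}(B))=0$ if and only if $\mu(B)=0$), and, for some constant $c>0$, $\mu(f^{-1}(B))\le c\,\mu(B)$ for every $B\in\mathcal B$. Let $T_f:L^p(X)\to L^p(X)$, $T_f\varphi=\varphi\circ f$, be the induced bounded composition operator on the complex space $L^p(X)=L^p(X,\mathcal B,\mu;\mathbb C)$, and assume that $T_f$ is invertible, i.e. that it has a bounded inverse. Suppose that the system is dissipative and of bounded distortion, generated by $W$: that is, $W\in\mathcal B$, $0<\mu(W)<\infty$, $X$ is the disjoint union of the sets $f^k(W)$, $k\in\mathbb Z$, and there is $K>0$ such that $$\frac1K\,\mu(f^k(W))\,\mu(B)\le \mu(f^k(B))\,\mu(W)\le K\,\mu(f^k(W))\,\mu(B)$$ for all $k\in\mathbb Z$ and all $B\in\mathcal B$ with $B\subseteq W$. If one of the following conditions holds: - $(\mathcal{HC})$ $\displaystyle\limsup_{n\to\infty}\ \sup_{k\in\mathbb Z}\left(\frac{\mu(f^k(W))}{\mu(f^{k+n}(W))}\right)^{1/n}<1$;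 - $(\mathcal{HD})$ $\displaystyle\liminf_{n\to\infty}\ \inf_{k\in\mathbb Z}\left(\frac{\mu(f^k(W))}{\mu(f^{k+n}(W))}\right)^{1/n}>1$; - $(\mathcal{GH})$ $\displaystyle\limsup_{n\to\infty}\ \sup_{k\in\mathbb Z,\,k\le 0}\left(\frac{\mu(f^{k-n}(W))}{\mu(f^{k}(W))}\right)^{1/n}<1$ and $\displaystyle\liminf_{n\to\infty}\ \inf_{k\in\mathbb Z,\,k\ge 0}\left(\frac{\mu(f^k(W))}{\mu(f^{k+n}(W))}\right)^{1/n}>1$; then $T_f$ is strongly structurally stable: for every $\gamma>0$ there is $\varepsilon>0$ such that for every bounded Lipschitz map $\phi:L^p(X)\to L^p(X)$ with $\|\phi\|_\infty\le\varepsilon$ and $\mathrm{Lip}(\phi)\le\varepsilon$ there is a homeomorphism $h:L^p(X)\to L^p(X)$ with $h\circ T_f=(T_f+\phi)\circ h$ and $\|h(x)-x\|\le\gamma$ for all $x\in L^p(X)$. -/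

import Mathlib

open MeasureTheory Filter
open scoped ENNReal NNReal BoundedContinuousFunction

/-- A bounded operator `T` on a complex Banach space `E` is strongly
structurally stable if it is invertible and for every `γ > 0` there is `ε > 0` such that for every
bounded continuous `φ : E → E` with sup norm at most `ε` and Lipschitz constant at most `ε` there is
a homeomorphism `h` of `E` with `h ∘ T = (T + φ) ∘ h` and `‖h - I‖_∞ ≤ γ`. -/
def StronglyStructurallyStable {E : Type*} [NormedAddCommGroup E] [NormedSpace ℂ E]
    (T : E →L[ℂ] E) : Prop :=
  IsUnit T ∧
    ∀ γ : ℝ, 0 < γ → ∃ ε : ℝ≥0, 0 < ε ∧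
      ∀ φ : E →ᵇ E, ‖φ‖ ≤ ε → LipschitzWith ε φ →
        ∃ h : E ≃ₜ E, (∀ x, h (T x) = T (h x) + φ (h x)) ∧ ∀ x, ‖h x - x‖ ≤ γ

/-- The image `f ^ k (B)` for an integer `k`. -/
def iterImage {X : Type*} [MeasurableSpace X] (f : X ≃ᵐ X) (k : ℤ) (B : Set X) : Set X :=
  ((f.toEquiv : Equiv.Perm X) ^ k) '' B

/-- The conditions on a measure space and an invertible bimeasurable transformation `f` under which
composition with `f` is a bounded operator on `L^p`: the measure is `σ`-finite and
`μ (f⁻¹ B) ≤ c μ B` for a constant `c > 0` and all measurable `B`. -/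
structure IsCompositionSystem {X : Type*} [MeasurableSpace X] (μ : Measure X) (f : X ≃ᵐ X) :
    Prop where
  sigmaFinite : SigmaFinite μ
  bound : ∃ c : ℝ≥0, 0 < c ∧ ∀ B : Set X, MeasurableSet B → μ (f ⁻¹' B) ≤ c * μ B

/-- `(X, μ, f)` is a dissipative system generated by `W`. -/
structure IsDissipativeSystem {X : Type*} [MeasurableSpace X] (μ : Measure X) (f : X ≃ᵐ X)
    (W : Set X) : Prop where
  nonsingular : ∀ B : Set X, MeasurableSet B → (μ (f ⁻¹' B) = 0 ↔ μ B = 0)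
  measurableSet : MeasurableSet W
  measure_pos : 0 < μ W
  measure_lt_top : μ W < ∞
  pairwise_disjoint : Pairwise fun j k : ℤ => Disjoint (iterImage f j W) (iterImage f k W)
  iUnion_eq : ⋃ k : ℤ, iterImage f k W = Set.univ

/-- `(X, μ, f)` is a dissipative system, of bounded distortion, generated by `W`. -/
structure IsDissipativeSystemOfBoundedDistortion {X : Type*} [MeasurableSpace X] (μ : Measure X)
    (f : X ≃ᵐ X) (W : Set X) : Prop extends IsDissipativeSystem μ f W where
  bounded_distortion : ∃ K : ℝ≥0, 0 < K ∧ ∀ (k : ℤ) (B : Set X), MeasurableSet B → B ⊆ W →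
    (K : ℝ≥0∞)⁻¹ * (μ (iterImage f k W) * μ B) ≤ μ (iterImage f k B) * μ W ∧
    μ (iterImage f k B) * μ W ≤ K * (μ (iterImage f k W) * μ B)

namespace IsCompositionSystem

variable {X : Type*} [MeasurableSpace X] {μ : Measure X} {f : X ≃ᵐ X}

theorem exists_map_le (h : IsCompositionSystem μ f) :
    ∃ c : ℝ≥0, μ.map f ≤ (c : ℝ≥0∞) • μ := by
  obtain ⟨c, -, hc⟩ := h.bound
  refine ⟨c, Measure.le_iff.2 fun B hB => ?_⟩
  rw [Measure.map_apply f.measurable hB]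
  simpa using hc B hB

theorem quasiMeasurePreserving (h : IsCompositionSystem μ f) :
    Measure.QuasiMeasurePreserving f μ μ := by
  obtain ⟨c, hc⟩ := h.exists_map_le
  exact ⟨f.measurable, Measure.absolutelyContinuous_of_le_smul hc⟩

theorem memLp_comp (h : IsCompositionSystem μ f) {p : ℝ≥0∞} {φ : X → ℂ} (hφ : MemLp φ p μ) :
    MemLp (φ ∘ f) p μ := by
  obtain ⟨c, hc⟩ := h.exists_map_le
  exact (hφ.of_measure_le_smul ENNReal.coe_ne_top hc).comp_of_map f.measurable.aemeasurable

/-- The linear map `φ ↦ φ ∘ f` on (classes of functions in) `L^p(μ)`. -/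
noncomputable def compLinear (h : IsCompositionSystem μ f) (p : ℝ≥0∞) :
    Lp ℂ p μ →ₗ[ℂ] Lp ℂ p μ where
  toFun φ := (h.memLp_comp (Lp.memLp φ)).toLp (φ ∘ f)
  map_add' φ ψ := by
    rw [← MemLp.toLp_add]
    exact MemLp.toLp_congr _ _ (h.quasiMeasurePreserving.ae_eq_comp (Lp.coeFn_add φ ψ))
  map_smul' a φ := by
    rw [RingHom.id_apply, ← MemLp.toLp_const_smul]
    exact MemLp.toLp_congr _ _ (h.quasiMeasurePreserving.ae_eq_comp (Lp.coeFn_smul a φ))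

theorem exists_bound (h : IsCompositionSystem μ f) (p : ℝ≥0∞) (hp : p ≠ ∞) :
    ∃ C : ℝ, ∀ φ : Lp ℂ p μ, ‖h.compLinear p φ‖ ≤ C * ‖φ‖ := by
  obtain ⟨c, hc⟩ := h.exists_map_le
  refine ⟨((c : ℝ≥0∞) ^ (1 / p).toReal).toReal, fun φ => ?_⟩
  have hfin : (c : ℝ≥0∞) ^ (1 / p).toReal ≠ ∞ :=
    ENNReal.rpow_ne_top_of_nonneg ENNReal.toReal_nonneg ENNReal.coe_ne_top
  have key : eLpNorm (φ ∘ f) p μ ≤ (c : ℝ≥0∞) ^ (1 / p).toReal * eLpNorm φ p μ := by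
    have hm : AEStronglyMeasurable φ (μ.map f) :=
      (Lp.aestronglyMeasurable φ).mono_ac h.quasiMeasurePreserving.absolutelyContinuous
    rw [← eLpNorm_map_measure hm f.measurable.aemeasurable]
    refine (eLpNorm_mono_measure _ hc).trans ?_
    rw [eLpNorm_smul_measure_of_ne_top hp, smul_eq_mul]
  change ‖(h.memLp_comp (Lp.memLp φ)).toLp (φ ∘ f)‖ ≤ _
  rw [Lp.norm_toLp, Lp.norm_def, ← ENNReal.toReal_mul]
  exact ENNReal.toReal_mono (ENNReal.mul_ne_top hfin (Lp.eLpNorm_ne_top φ)) key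

/-- The composition operator `T_f : φ ↦ φ ∘ f`, a bounded operator on `L^p(μ)`, `1 ≤ p < ∞`. -/
noncomputable def compositionOperator (h : IsCompositionSystem μ f) (p : ℝ≥0∞) [Fact (1 ≤ p)]
    (hp : p ≠ ∞) : Lp ℂ p μ →L[ℂ] Lp ℂ p μ :=
  (h.compLinear p).mkContinuousOfExistsBound (h.exists_bound p hp)

end IsCompositionSystem

/-- Condition `HC`: `limsup_n sup_{k ∈ ℤ} (μ(f^k W) / μ(f^(k+n) W))^(1/n) < 1`. All three conditions
are stated in `[0, ∞]`; for the systems considered every `μ(f^k W)` is positive and finite. -/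
def ConditionHC {X : Type*} [MeasurableSpace X] (μ : Measure X) (f : X ≃ᵐ X) (W : Set X) : Prop :=
  limsup (fun n : ℕ => ⨆ k : ℤ,
    (μ (iterImage f k W) / μ (iterImage f (k + n) W)) ^ (1 / (n : ℝ))) atTop < 1

/-- Condition `HD`: `liminf_n inf_{k ∈ ℤ} (μ(f^k W) / μ(f^(k+n) W))^(1/n) > 1`. -/
def ConditionHD {X : Type*} [MeasurableSpace X] (μ : Measure X) (f : X ≃ᵐ X) (W : Set X) : Prop :=
  1 < liminf (fun n : ℕ => ⨅ k : ℤ,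
    (μ (iterImage f k W) / μ (iterImage f (k + n) W)) ^ (1 / (n : ℝ))) atTop

/-- Condition `GH`: `limsup_n sup_{k ≤ 0} (μ(f^(k-n) W) / μ(f^k W))^(1/n) < 1` and
`liminf_n inf_{k ≥ 0} (μ(f^k W) / μ(f^(k+n) W))^(1/n) > 1`. -/
def ConditionGH {X : Type*} [MeasurableSpace X] (μ : Measure X) (f : X ≃ᵐ X) (W : Set X) : Prop :=
  limsup (fun n : ℕ => ⨆ k : {k : ℤ // k ≤ 0},
    (μ (iterImage f (k - n) W) / μ (iterImage f k W)) ^ (1 / (n : ℝ))) atTop < 1 ∧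
  1 < liminf (fun n : ℕ => ⨅ k : {k : ℤ // 0 ≤ k},
    (μ (iterImage f k W) / μ (iterImage f (k + n) W)) ^ (1 / (n : ℝ))) atTop

/-! The theorem rests on a splitting of `L^p` adapted to `T = T_f`. `T` carries functions supported
on `f^k(W)` to functions supported on `f^(k-1)(W)`, and bounded distortion makes the norm change
comparable to the ratio of the measures of these pieces. Take `P` to be multiplication by the
indicator of the pieces with index in `S`, where `S` is `ℤ`, `∅` or `{k ≤ 0}` under HC, HD, GH
respectively. Then `‖T^k P‖` and `‖T^(-k) (1 - P)‖` decay geometrically.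

For such a splitting, `u ∘ R - T ∘ u = ψ` has a bounded solution `greenOperator`, linear in `ψ`.
Under GH the range of `1 - P` need not be `T`-invariant and bounded solutions need not be unique, so
the usual uniqueness argument for inverting the conjugacy is unavailable. Instead the same explicit
formula produces maps `h` and `k` in the two directions. Its naturality under semiconjugacies gives
`k ∘ h = id`, and a contraction estimate gives `h ∘ k = id`. -/

/-! ### Bounded solutions of the cohomological equation. -/

section GreenOperator

variable {E : Type*} [NormedAddCommGroup E] [NormedSpace ℂ E]

/-- For `T` with inverse `U` and a homeomorphism `R`, the formal solution `u` of the cohomological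
equation `u ∘ R - T ∘ u = ψ` obtained by summing the `P`-part of `ψ` over the past and the
complementary part over the future. -/
noncomputable def greenOperator (T U P : E →L[ℂ] E) (R : E ≃ₜ E) (ψ : E → E) (x : E) : E :=
  ∑' k : ℕ, (T ^ k * P) (ψ (R.symm^[k + 1] x)) -
    ∑' k : ℕ, (U ^ (k + 1) * (1 - P)) (ψ (R^[k] x))

variable {T U P : E →L[ℂ] E}

theorem summable_apply_of_bounded [CompleteSpace E] {A : ℕ → E →L[ℂ] E}
    (hA : Summable fun k => ‖A k‖) {v : ℕ → E} {M : ℝ} (hv : ∀ k, ‖v k‖ ≤ M) :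
    Summable fun k => A k (v k) :=
  .of_norm_bounded (hA.mul_right M) fun k =>
    ((A k).le_opNorm _).trans (mul_le_mul_of_nonneg_left (hv k) (norm_nonneg _))

theorem norm_tsum_apply_le [CompleteSpace E] {A : ℕ → E →L[ℂ] E}
    (hA : Summable fun k => ‖A k‖) {v : ℕ → E} {M : ℝ} (hv : ∀ k, ‖v k‖ ≤ M) :
    ‖∑' k, A k (v k)‖ ≤ (∑' k, ‖A k‖) * M := by
  rw [← hA.tsum_mul_right]
  exact tsum_of_norm_bounded (hA.mul_right M).hasSum fun k =>
    ((A k).le_opNorm _).trans (mul_le_mul_of_nonneg_left (hv k) (norm_nonneg _))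

theorem continuous_tsum_apply [CompleteSpace E] {A : ℕ → E →L[ℂ] E} (hA : Summable fun k => ‖A k‖)
    {v : ℕ → E → E} {M : ℝ} (hv : ∀ k x, ‖v k x‖ ≤ M) (hc : ∀ k, Continuous (v k)) :
    Continuous fun x => ∑' k, A k (v k x) :=
  continuous_tsum (fun k => (A k).continuous.comp (hc k)) (hA.mul_right M) fun k x =>
    ((A k).le_opNorm _).trans (mul_le_mul_of_nonneg_left (hv k x) (norm_nonneg _))

theorem norm_greenOperator_le [CompleteSpace E] (hA : Summable fun k : ℕ => ‖T ^ k * P‖)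
    (hB : Summable fun k : ℕ => ‖U ^ (k + 1) * (1 - P)‖) (R : E ≃ₜ E) {ψ : E → E} {M : ℝ}
    (hψ : ∀ x, ‖ψ x‖ ≤ M) (x : E) :
    ‖greenOperator T U P R ψ x‖ ≤
      (∑' k : ℕ, ‖T ^ k * P‖ + ∑' k : ℕ, ‖U ^ (k + 1) * (1 - P)‖) * M := by
  rw [add_mul]
  exact (norm_sub_le _ _).trans (add_le_add (norm_tsum_apply_le hA fun _ => hψ _)
    (norm_tsum_apply_le hB fun _ => hψ _))

theorem continuous_greenOperator [CompleteSpace E] (hA : Summable fun k : ℕ => ‖T ^ k * P‖)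
    (hB : Summable fun k : ℕ => ‖U ^ (k + 1) * (1 - P)‖) (R : E ≃ₜ E) {ψ : E → E} {M : ℝ}
    (hψ : ∀ x, ‖ψ x‖ ≤ M) (hc : Continuous ψ) : Continuous (greenOperator T U P R ψ) :=
  (continuous_tsum_apply hA (fun _ _ => hψ _)
    fun k => hc.comp (R.symm.continuous.iterate (k + 1))).sub
    (continuous_tsum_apply hB (fun _ _ => hψ _) fun k => hc.comp (R.continuous.iterate k))

theorem greenOperator_sub [CompleteSpace E] (hA : Summable fun k : ℕ => ‖T ^ k * P‖)
    (hB : Summable fun k : ℕ => ‖U ^ (k + 1) * (1 - P)‖) (R : E ≃ₜ E) {ψ₁ ψ₂ : E → E}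
    {M₁ M₂ : ℝ} (h₁ : ∀ x, ‖ψ₁ x‖ ≤ M₁) (h₂ : ∀ x, ‖ψ₂ x‖ ≤ M₂) (x : E) :
    greenOperator T U P R ψ₁ x - greenOperator T U P R ψ₂ x =
      greenOperator T U P R (fun y => ψ₁ y - ψ₂ y) x := by
  simp only [greenOperator, map_sub]
  rw [(summable_apply_of_bounded hA fun _ => h₁ _).tsum_sub
      (summable_apply_of_bounded hA fun _ => h₂ _),
    (summable_apply_of_bounded hB fun _ => h₁ _).tsum_sub
      (summable_apply_of_bounded hB fun _ => h₂ _)]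
  abel

/-- Both series telescope: evaluating the past sum at `R x` releases the term `P (ψ x)`, and
applying `T` to the future sum releases `(1 - P) (ψ x)`. Neither `P * P = P` nor any invariance
under `T` enters. -/
theorem greenOperator_apply_homeomorph [CompleteSpace E] (hTU : T * U = 1)
    (hA : Summable fun k : ℕ => ‖T ^ k * P‖)
    (hB : Summable fun k : ℕ => ‖U ^ (k + 1) * (1 - P)‖) (R : E ≃ₜ E) {ψ : E → E} {M : ℝ}
    (hψ : ∀ x, ‖ψ x‖ ≤ M) (x : E) :
    greenOperator T U P R ψ (R x) = T (greenOperator T U P R ψ x) + ψ x := by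
  have sA : ∀ y, Summable fun k : ℕ => (T ^ k * P) (ψ (R.symm^[k + 1] y)) := fun y =>
    summable_apply_of_bounded hA fun _ => hψ _
  have sB : ∀ y, Summable fun k : ℕ => (U ^ (k + 1) * (1 - P)) (ψ (R^[k] y)) := fun y =>
    summable_apply_of_bounded hB fun _ => hψ _
  have e₁ : ∑' k : ℕ, (T ^ k * P) (ψ (R.symm^[k + 1] (R x))) =
      P (ψ x) + T (∑' k : ℕ, (T ^ k * P) (ψ (R.symm^[k + 1] x))) := by
    rw [(sA (R x)).tsum_eq_zero_add, T.map_tsum (sA x)]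
    congr 1
    · simp
    · refine tsum_congr fun k => ?_
      rw [Function.iterate_succ_apply, R.symm_apply_apply, pow_succ']
      rfl
  have e₂ : T (∑' k : ℕ, (U ^ (k + 1) * (1 - P)) (ψ (R^[k] x))) =
      (ψ x - P (ψ x)) + ∑' k : ℕ, (U ^ (k + 1) * (1 - P)) (ψ (R^[k] (R x))) := by
    have hT : ∀ (k : ℕ) y, T ((U ^ (k + 1) * (1 - P)) y) = (U ^ k * (1 - P)) y := fun k y => by
      change (T * (U ^ (k + 1) * (1 - P))) y = _
      rw [pow_succ', ← mul_assoc, ← mul_assoc, hTU, one_mul]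
    rw [T.map_tsum (sB x), (T.summable (sB x)).tsum_eq_zero_add]
    simp only [hT]
    simp [Function.iterate_succ_apply]
  rw [greenOperator, e₁, greenOperator, map_sub, e₂]
  abel

/-- Naturality of the formula: a semiconjugacy carries orbits, forward and backward, to orbits. This
replaces uniqueness of bounded solutions when the two conjugacies are composed. -/
theorem greenOperator_comp_semiconj {R R' : E ≃ₜ E} {h : E → E} (hR : ∀ x, h (R x) = R' (h x))
    (ψ : E → E) (x : E) :
    greenOperator T U P R (ψ ∘ h) x = greenOperator T U P R' ψ (h x) := by
  have h₁ : Function.Semiconj h R R' := hR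
  have h₂ : Function.Semiconj h R.symm R'.symm := fun y => by
    rw [R'.eq_symm_apply, ← hR, R.apply_symm_apply]
  simp only [greenOperator, Function.comp_apply, (h₁.iterate_right _).eq, (h₂.iterate_right _).eq]

end GreenOperator

/-! ### Structural stability from a summable splitting. -/

/-- An invertible operator for which the forward orbits of the range of `P` and the backward orbits
of the range of `1 - P` decay summably is strongly structurally stable. -/
theorem stronglyStructurallyStable_of_summable {E : Type*} [NormedAddCommGroup E] [NormedSpace ℂ E]
    [CompleteSpace E] {T U P : E →L[ℂ] E} (hTU : T * U = 1) (hUT : U * T = 1)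
    (hA : Summable fun k : ℕ => ‖T ^ k * P‖)
    (hB : Summable fun k : ℕ => ‖U ^ (k + 1) * (1 - P)‖) :
    StronglyStructurallyStable T := by
  refine ⟨⟨⟨T, U, hTU, hUT⟩, rfl⟩, fun γ hγ => ?_⟩
  set C : ℝ := ∑' k : ℕ, ‖T ^ k * P‖ + ∑' k : ℕ, ‖U ^ (k + 1) * (1 - P)‖
  have hC0 : 0 ≤ C := add_nonneg (tsum_nonneg fun _ => norm_nonneg _)
    (tsum_nonneg fun _ => norm_nonneg _)
  let e : E ≃L[ℂ] E := ContinuousLinearEquiv.equivOfInverse T U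
    (fun x => DFunLike.congr_fun hUT x) (fun x => DFunLike.congr_fun hTU x)
  -- The three bounds serve, in order, closeness of `h` to the identity, the contraction estimates,
  -- and invertibility of `T + φ` as a Lipschitz perturbation of `T`. The last bound cannot hold on
  -- the zero space, hence the alternative.
  obtain ⟨ε, hε, hεγ, hεC, hεe⟩ : ∃ ε : ℝ≥0, 0 < ε ∧ C * ε ≤ γ ∧ C * ε ≤ 1 / 2 ∧
      (Subsingleton E ∨ ε < ‖(e.symm : E →L[ℂ] E)‖₊⁻¹) := by
    have h₁ : ∀ᶠ t : ℝ≥0 in nhdsWithin 0 (Set.Ioi 0), C * t < min γ (1 / 2) := by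
      refine nhdsWithin_le_nhds (ContinuousAt.eventually_lt (by fun_prop) (by fun_prop) ?_)
      simp [hγ]
    have h₂ : ∀ᶠ t : ℝ≥0 in nhdsWithin 0 (Set.Ioi 0),
        Subsingleton E ∨ t < ‖(e.symm : E →L[ℂ] E)‖₊⁻¹ := by
      rcases subsingleton_or_nontrivial E with h | h
      · exact .of_forall fun _ => .inl h
      · refine Eventually.mono (nhdsWithin_le_nhds (eventually_lt_nhds ?_)) fun _ => .inr
        simpa using e.symm.norm_pos
    obtain ⟨ε, ⟨h₁, h₂⟩, h₃⟩ := ((h₁.and h₂).and self_mem_nhdsWithin).exists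
    exact ⟨ε, h₃, (h₁.trans_le (min_le_left _ _)).le, (h₁.trans_le (min_le_right _ _)).le, h₂⟩
  refine ⟨ε, hε, fun φ hφ hLip => ?_⟩
  have hφε : ∀ x, ‖φ x‖ ≤ ε := fun x => (φ.norm_coe_le_norm x).trans hφ
  have happrox : ApproximatesLinearOn (fun x => T x + φ x) (e : E →L[ℂ] E) Set.univ ε := by
    refine fun x _ y _ => ?_
    have : T x + φ x - (T y + φ y) - (e : E →L[ℂ] E) (x - y) = φ x - φ y := by
      change _ - T (x - y) = _
      rw [map_sub]; abel
    rw [this]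
    exact hLip.norm_sub_le x y
  let R : E ≃ₜ E := happrox.toHomeomorph _ hεe
  have hR : ∀ x, R x = T x + φ x := fun x => rfl
  let S : E ≃ₜ E := e.toHomeomorph
  have hS : ∀ x, S x = T x := fun x => rfl
  have hc : ∀ u : E →ᵇ E, Continuous fun x => φ (x + u x) := fun u => by fun_prop
  -- With `h = id + u`, the conjugacy equation reads `u ∘ T - T ∘ u = φ ∘ h`; a fixed point of `F`
  -- solves it.
  let F : (E →ᵇ E) → (E →ᵇ E) := fun u => BoundedContinuousFunction.ofNormedAddCommGroup
    (greenOperator T U P S fun x => φ (x + u x))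
    (continuous_greenOperator hA hB S (fun x => hφε _) (hc u)) (C * ε)
    (norm_greenOperator_le hA hB S fun x => hφε _)
  have hF : ContractingWith (1 / 2) F := by
    refine ⟨by rw [← NNReal.coe_lt_coe]; norm_num, LipschitzWith.of_dist_le_mul fun u v => ?_⟩
    refine (BoundedContinuousFunction.dist_le (by positivity)).2 fun x => ?_
    rw [dist_eq_norm]
    change ‖greenOperator T U P S (fun x => φ (x + u x)) x -
      greenOperator T U P S (fun x => φ (x + v x)) x‖ ≤ _
    rw [greenOperator_sub hA hB S (fun x => hφε _) (fun x => hφε _)]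
    refine (norm_greenOperator_le hA hB S (M := ε * dist u v) (fun y => ?_) x).trans ?_
    · refine (hLip.norm_sub_le _ _).trans (mul_le_mul_of_nonneg_left ?_ ε.2)
      rw [add_sub_add_left_eq_sub, ← dist_eq_norm]
      exact BoundedContinuousFunction.dist_coe_le_dist y
    · rw [← mul_assoc]
      exact mul_le_mul_of_nonneg_right (by simpa using hεC) dist_nonneg
  obtain ⟨u, hu⟩ : ∃ u, F u = u := ⟨_, hF.fixedPoint_isFixedPt⟩
  let h : E → E := fun x => x + u x
  have hu' : ∀ x, u x = greenOperator T U P S (φ ∘ h) x := fun x => by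
    conv_lhs => rw [← hu]
    rfl
  have hsemi : ∀ x, h (S x) = R (h x) := fun x => by
    change S x + u (S x) = T (x + u x) + φ (h x)
    rw [hu', greenOperator_apply_homeomorph hTU hA hB S (ψ := φ ∘ h) (fun x => hφε _), ← hu', map_add, hS]
    simp only [Function.comp_apply]
    abel
  -- In the reverse direction the equation is linear, with right-hand side `φ` itself, so no fixed
  -- point is needed.
  let k : E → E := fun x => x - greenOperator T U P R φ x
  have ksemi : ∀ x, k (R x) = S (k x) := fun x => by
    change R x - greenOperator T U P R φ (R x) = T (x - greenOperator T U P R φ x)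
    rw [greenOperator_apply_homeomorph hTU hA hB R hφε, map_sub, hR]
    abel
  have kh : ∀ x, k (h x) = x := fun x => by
    change x + u x - greenOperator T U P R φ (h x) = x
    rw [← greenOperator_comp_semiconj hsemi, ← hu', add_sub_cancel_right]
  have hk_sub : ∀ x, h (k x) - x = greenOperator T U P R (fun y => φ (h (k y)) - φ y) x := fun x => by
    change k x + u (k x) - x = _
    rw [hu', ← greenOperator_comp_semiconj ksemi,
      ← greenOperator_sub hA hB R (fun x => hφε _) hφε]
    change x - greenOperator T U P R φ x + _ - x = _
    rw [show (φ ∘ h) ∘ k = fun y => φ (h (k y)) from rfl]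
    abel
  -- By `hk_sub` and the Lipschitz bound on `φ`, any uniform bound on `h ∘ k - id` improves by the
  -- factor `C * ε ≤ 1 / 2`.
  have hk_bound : ∀ n : ℕ, ∀ x, ‖h (k x) - x‖ ≤ (1 / 2) ^ n * (C * (ε + ε)) := fun n => by
    induction n with
    | zero =>
      intro x
      rw [hk_sub, pow_zero, one_mul]
      exact norm_greenOperator_le hA hB R
        (fun y => (norm_sub_le _ _).trans (add_le_add (hφε _) (hφε _))) x
    | succ n ih =>
      intro x
      rw [hk_sub]
      refine (norm_greenOperator_le hA hB R (M := ε * ((1 / 2) ^ n * (C * (ε + ε))))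
        (fun y => (hLip.norm_sub_le _ _).trans (mul_le_mul_of_nonneg_left (ih y) ε.2)) x).trans ?_
      rw [← mul_assoc, pow_succ', mul_assoc (1 / 2 : ℝ)]
      exact mul_le_mul_of_nonneg_right hεC (by positivity)
  have hk : ∀ x, h (k x) = x := fun x => by
    rw [← sub_eq_zero, ← norm_le_zero_iff]
    refine ge_of_tendsto' (x := atTop) (f := fun n : ℕ => (1 / 2 : ℝ) ^ n * (C * (ε + ε))) (b := ‖h (k x) - x‖)
      ?_ fun n => hk_bound n x
    simpa using (tendsto_pow_atTop_nhds_zero_of_lt_one (r := (1 / 2 : ℝ))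
      (by norm_num) (by norm_num)).mul_const (C * (ε + ε))
  refine ⟨⟨⟨h, k, kh, hk⟩, continuous_id.add u.continuous,
    continuous_id.sub (continuous_greenOperator hA hB R hφε φ.continuous)⟩, hsemi, fun x => ?_⟩
  change ‖x + u x - x‖ ≤ γ
  rw [add_sub_cancel_left, hu']
  exact (norm_greenOperator_le hA hB S (fun x => hφε _) x).trans hεγ

/-! ### Translates of `W` and bounded distortion. -/

section IterImage

variable {X : Type*} [MeasurableSpace X] {μ : Measure X} {f : X ≃ᵐ X} {W : Set X}

theorem iterImage_zero (B : Set X) : iterImage f 0 B = B := by simp [iterImage]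

theorem iterImage_add (j k : ℤ) (B : Set X) :
    iterImage f (j + k) B = iterImage f j (iterImage f k B) := by
  simp [iterImage, zpow_add, Set.image_image]

theorem iterImage_natCast (n : ℕ) (B : Set X) : iterImage f n B = f^[n] '' B := by
  rw [iterImage, zpow_natCast, ← Equiv.Perm.iterate_eq_pow]
  rfl

theorem iterImage_neg_natCast (n : ℕ) (B : Set X) : iterImage f (-n) B = f^[n] ⁻¹' B := by
  have h := iterImage_add (f := f) n (-n) B
  rw [add_neg_cancel, iterImage_zero, iterImage_natCast] at h
  conv_rhs => rw [h]
  rw [Set.preimage_image_eq _ (f.injective.iterate n)]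

theorem iterImage_mono (k : ℤ) {B C : Set X} (h : B ⊆ C) : iterImage f k B ⊆ iterImage f k C :=
  Set.image_mono h

theorem MeasurableEquiv.measurableEmbedding_iterate (f : X ≃ᵐ X) (n : ℕ) :
    MeasurableEmbedding f^[n] := by
  induction n with
  | zero => exact .id
  | succ n ih => exact ih.comp f.measurableEmbedding

theorem measurableSet_iterImage (k : ℤ) {B : Set X} (hB : MeasurableSet B) :
    MeasurableSet (iterImage f k B) := by
  obtain ⟨n, rfl | rfl⟩ := k.eq_nat_or_neg
  · rw [iterImage_natCast]
    exact (f.measurableEmbedding_iterate n).measurableSet_image.2 hB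
  · rw [iterImage_neg_natCast]
    exact (f.measurable.iterate n) hB

namespace IsDissipativeSystem

theorem measure_preimage_iterate_eq_zero_iff (h : IsDissipativeSystem μ f W) (n : ℕ) {B : Set X}
    (hB : MeasurableSet B) : μ (f^[n] ⁻¹' B) = 0 ↔ μ B = 0 := by
  induction n with
  | zero => simp
  | succ n ih =>
    rw [Function.iterate_succ, Set.preimage_comp, h.nonsingular _ (f.measurable.iterate n hB), ih]

theorem measure_iterImage_ne_zero (h : IsDissipativeSystem μ f W) (k : ℤ) :
    μ (iterImage f k W) ≠ 0 := by
  obtain ⟨n, rfl | rfl⟩ := k.eq_nat_or_neg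
  · rw [Ne, ← h.measure_preimage_iterate_eq_zero_iff n (measurableSet_iterImage _ h.measurableSet),
      ← iterImage_neg_natCast, ← iterImage_add, neg_add_cancel, iterImage_zero]
    exact h.measure_pos.ne'
  · rw [iterImage_neg_natCast, Ne, h.measure_preimage_iterate_eq_zero_iff n h.measurableSet]
    exact h.measure_pos.ne'

end IsDissipativeSystem

/-- Under bounded distortion, comparing the measures of the translates of `W` by `m` compares the
measures of the translates by `m` of all sets. -/
theorem IsDissipativeSystemOfBoundedDistortion.exists_measure_iterImage_le
    (h : IsDissipativeSystemOfBoundedDistortion μ f W) :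
    ∃ C : ℝ≥0∞, C ≠ ∞ ∧ ∀ (m : ℤ) (S : Set ℤ) (c : ℝ≥0∞),
      (∀ k ∈ S, μ (iterImage f (m + k) W) ≤ c * μ (iterImage f k W)) →
      ∀ B, MeasurableSet B → B ⊆ ⋃ k ∈ S, iterImage f k W →
        μ (iterImage f m B) ≤ C * c * μ B := by
  obtain ⟨K, hK, hdist⟩ := h.bounded_distortion
  have hK0 : (K : ℝ≥0∞) ≠ 0 := by simpa using hK.ne'
  refine ⟨K * K, ENNReal.mul_ne_top ENNReal.coe_ne_top ENNReal.coe_ne_top,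
    fun m S c hc B hB hBS => ?_⟩
  -- Distortion is used twice, from above at index `m + k` and from below at index `k`, whence the
  -- constant `K * K`. A general `B` is then cut along the disjoint translates of `W`.
  have piece : ∀ k ∈ S, ∀ D, MeasurableSet D → D ⊆ W →
      μ (iterImage f (m + k) D) ≤ K * K * c * μ (iterImage f k D) := fun k hk D hD hDW => by
    rw [← ENNReal.mul_le_mul_iff_left h.measure_pos.ne' h.measure_lt_top.ne]
    have h₂ : μ (iterImage f k W) * μ D ≤ K * (μ (iterImage f k D) * μ W) := by
      have := mul_le_mul_right (hdist k D hD hDW).1 (K : ℝ≥0∞)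
      rwa [← mul_assoc, ENNReal.mul_inv_cancel hK0 ENNReal.coe_ne_top, one_mul] at this
    calc μ (iterImage f (m + k) D) * μ W
        ≤ K * (μ (iterImage f (m + k) W) * μ D) := (hdist (m + k) D hD hDW).2
      _ ≤ K * (c * μ (iterImage f k W) * μ D) := by gcongr; exact hc k hk
      _ = K * c * (μ (iterImage f k W) * μ D) := by ring
      _ ≤ K * c * (K * (μ (iterImage f k D) * μ W)) := by gcongr
      _ = K * K * c * μ (iterImage f k D) * μ W := by ring
  have hWk := fun k : ℤ => measurableSet_iterImage (f := f) k h.measurableSet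
  have hcover : B = ⋃ k : S, B ∩ iterImage f k W := by
    rw [← Set.inter_iUnion, eq_comm, Set.inter_eq_left]
    rwa [Set.iUnion_subtype]
  have himage : iterImage f m B = ⋃ k : S, iterImage f m (B ∩ iterImage f k W) := by
    conv_lhs => rw [hcover]
    simp only [iterImage, Set.image_iUnion]
  have hμB : μ B = ∑' k : S, μ (B ∩ iterImage f k W) := by
    conv_lhs => rw [hcover]
    refine measure_iUnion (fun i j hij => ?_) fun k => hB.inter (hWk k)
    exact (h.pairwise_disjoint (Subtype.coe_injective.ne hij)).mono Set.inter_subset_right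
      Set.inter_subset_right
  rw [himage, hμB, ← ENNReal.tsum_mul_left]
  refine (measure_iUnion_le _).trans (ENNReal.tsum_le_tsum fun k => ?_)
  have hback : ∀ D : Set X, iterImage f k (iterImage f (-k) D) = D := fun D => by
    rw [← iterImage_add, add_neg_cancel, iterImage_zero]
  have := piece k k.2 (iterImage f (-k) (B ∩ iterImage f k W))
    (measurableSet_iterImage _ (hB.inter (hWk k))) ((iterImage_mono _ Set.inter_subset_right).trans
      (by rw [← iterImage_add, neg_add_cancel, iterImage_zero]))
  rwa [iterImage_add, hback] at this

end IterImage

/-! ### Norms of powers of the composition operator on the pieces. -/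

section CompositionOperator

variable {X : Type*} [MeasurableSpace X] {μ : Measure X} {p : ℝ≥0∞}

/-- Multiplication by the indicator function of a measurable set, as a linear map on `L^p`. -/
noncomputable def lpIndicatorLinear (μ : Measure X) (p : ℝ≥0∞) {A : Set X}
    (hA : MeasurableSet A) : Lp ℂ p μ →ₗ[ℂ] Lp ℂ p μ where
  toFun φ := ((Lp.memLp φ).indicator hA).toLp (A.indicator φ)
  map_add' φ ψ := by
    rw [← MemLp.toLp_add]
    refine MemLp.toLp_congr _ _ ?_
    filter_upwards [Lp.coeFn_add φ ψ] with x hx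
    by_cases hxA : x ∈ A
    · simpa only [Pi.add_apply, Set.indicator_of_mem hxA] using hx
    · simp [hxA]
  map_smul' a φ := by
    rw [RingHom.id_apply, ← MemLp.toLp_const_smul]
    refine MemLp.toLp_congr _ _ ?_
    filter_upwards [Lp.coeFn_smul a φ] with x hx
    by_cases hxA : x ∈ A
    · simpa only [Pi.smul_apply, Set.indicator_of_mem hxA] using hx
    · simp [hxA]

theorem lpIndicatorLinear_coeFn {A : Set X} (hA : MeasurableSet A) (φ : Lp ℂ p μ) :
    lpIndicatorLinear μ p hA φ =ᵐ[μ] A.indicator φ := by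
  change ((Lp.memLp φ).indicator hA).toLp (A.indicator φ) =ᵐ[μ] _
  exact MemLp.coeFn_toLp _

/-- Multiplication by the indicator function of a measurable set, as an operator on `L^p`. -/
noncomputable def lpIndicator (μ : Measure X) (p : ℝ≥0∞) [Fact (1 ≤ p)] {A : Set X}
    (hA : MeasurableSet A) : Lp ℂ p μ →L[ℂ] Lp ℂ p μ :=
  (lpIndicatorLinear μ p hA).mkContinuous 1 fun φ => by
    rw [one_mul, Lp.norm_def, Lp.norm_def, eLpNorm_congr_ae (lpIndicatorLinear_coeFn hA φ)]
    exact ENNReal.toReal_mono (Lp.eLpNorm_ne_top φ) (eLpNorm_indicator_le _)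

variable [Fact (1 ≤ p)]

theorem lpIndicator_coeFn {A : Set X} (hA : MeasurableSet A) (φ : Lp ℂ p μ) :
    lpIndicator μ p hA φ =ᵐ[μ] A.indicator φ :=
  lpIndicatorLinear_coeFn hA φ

theorem one_sub_lpIndicator {A : Set X} (hA : MeasurableSet A) :
    1 - lpIndicator μ p hA = lpIndicator μ p hA.compl := by
  ext φ
  change (φ - lpIndicator μ p hA φ : Lp ℂ p μ) =ᵐ[μ] _
  filter_upwards [Lp.coeFn_sub φ (lpIndicator μ p hA φ), lpIndicator_coeFn hA φ,
    lpIndicator_coeFn hA.compl φ] with x h₁ h₂ h₃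
  rw [h₁, h₃, Set.indicator_compl, Pi.sub_apply, Pi.sub_apply, h₂]

variable {f : X ≃ᵐ X} {W : Set X}

namespace IsCompositionSystem

theorem compositionOperator_pow_coeFn (h : IsCompositionSystem μ f) (hp : p ≠ ∞) (n : ℕ)
    (φ : Lp ℂ p μ) : (h.compositionOperator p hp ^ n) φ =ᵐ[μ] φ ∘ f^[n] := by
  induction n with
  | zero => rfl
  | succ n ih =>
    rw [pow_succ']
    have h₁ : h.compositionOperator p hp ((h.compositionOperator p hp ^ n) φ) =ᵐ[μ]
      (h.compositionOperator p hp ^ n) φ ∘ f := MemLp.coeFn_toLp (h.memLp_comp (Lp.memLp _))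
    exact h₁.trans (h.quasiMeasurePreserving.ae_eq_comp ih)

/-- By change of variables, the norm of `(A.indicator φ) ∘ f^[n]` is the norm of `φ` for the
pushforward of `μ` restricted to `A`, which is at most `c • μ`. -/
theorem norm_compositionOperator_pow_mul_lpIndicator_le (h : IsCompositionSystem μ f)
    (hp : p ≠ ∞) (n : ℕ) {A : Set X} (hA : MeasurableSet A) {c : ℝ≥0∞} (hc : c ≠ ∞)
    (hAc : ∀ B, MeasurableSet B → B ⊆ A → μ (iterImage f (-n) B) ≤ c * μ B) :
    ‖h.compositionOperator p hp ^ n * lpIndicator μ p hA‖ ≤ (c ^ (1 / p).toReal).toReal := by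
  have hq := h.quasiMeasurePreserving.iterate n
  have hle : (μ.map f^[n]).restrict A ≤ c • μ := Measure.le_iff.2 fun B hB => by
    rw [Measure.restrict_apply hB, Measure.map_apply hq.measurable (hB.inter hA),
      ← iterImage_neg_natCast]
    exact (hAc _ (hB.inter hA) Set.inter_subset_right).trans
      (mul_le_mul_right (measure_mono Set.inter_subset_left) _)
  refine ContinuousLinearMap.opNorm_le_bound _ ENNReal.toReal_nonneg fun φ => ?_
  rw [Lp.norm_def, Lp.norm_def, ← ENNReal.toReal_mul]
  refine ENNReal.toReal_mono (ENNReal.mul_ne_top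
    (ENNReal.rpow_ne_top_of_nonneg ENNReal.toReal_nonneg hc) (Lp.eLpNorm_ne_top φ)) ?_
  calc eLpNorm ((h.compositionOperator p hp ^ n) (lpIndicator μ p hA φ)) p μ
      = eLpNorm (A.indicator φ ∘ f^[n]) p μ := eLpNorm_congr_ae
        ((h.compositionOperator_pow_coeFn hp n _).trans (hq.ae_eq_comp (lpIndicator_coeFn hA φ)))
    _ = eLpNorm φ p ((μ.map f^[n]).restrict A) := by
      rw [← eLpNorm_indicator_eq_eLpNorm_restrict hA, eLpNorm_map_measure _ hq.aemeasurable]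
      exact ((Lp.aestronglyMeasurable φ).indicator hA).mono_ac hq.absolutelyContinuous
    _ ≤ eLpNorm φ p (c • μ) := eLpNorm_mono_measure _ hle
    _ = c ^ (1 / p).toReal * eLpNorm φ p μ := by
      rw [eLpNorm_smul_measure_of_ne_top hp, smul_eq_mul]

/-- `U` is only an abstract inverse, so `η = U^n (A.indicator φ)` is read off from `η ∘ f^[n] =
A.indicator φ` almost everywhere. Hence `η` lives on `f^n(A)`, where `μ` is at most `c` times the
pushforward. Non-singularity transfers null sets of the pushforward back to `μ`. -/
theorem norm_inverse_pow_mul_lpIndicator_le (h : IsCompositionSystem μ f)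
    (hW : IsDissipativeSystem μ f W) (hp : p ≠ ∞) {U : Lp ℂ p μ →L[ℂ] Lp ℂ p μ}
    (hU : h.compositionOperator p hp * U = 1) (hU' : U * h.compositionOperator p hp = 1) (n : ℕ)
    {A : Set X} (hA : MeasurableSet A) {c : ℝ≥0∞} (hc : c ≠ ∞)
    (hAc : ∀ B, MeasurableSet B → B ⊆ A → μ (iterImage f n B) ≤ c * μ B) :
    ‖U ^ n * lpIndicator μ p hA‖ ≤ (c ^ (1 / p).toReal).toReal := by
  have hq := h.quasiMeasurePreserving.iterate n
  have hD : MeasurableSet (iterImage f n A) := measurableSet_iterImage _ hA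
  have hpre : f^[n] ⁻¹' iterImage f n A = A := by
    rw [iterImage_natCast, Set.preimage_image_eq _ (f.injective.iterate n)]
  have hle : μ.restrict (iterImage f n A) ≤ c • μ.map f^[n] := Measure.le_iff.2 fun B hB => by
    rw [Measure.restrict_apply hB, Measure.smul_apply, Measure.map_apply hq.measurable hB]
    have := hAc (f^[n] ⁻¹' (B ∩ iterImage f n A)) (hq.measurable (hB.inter hD))
      ((Set.preimage_mono Set.inter_subset_right).trans hpre.subset)
    rw [← iterImage_neg_natCast, ← iterImage_add, add_neg_cancel, iterImage_zero,
      iterImage_neg_natCast] at this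
    exact this.trans (mul_le_mul_right (measure_mono (Set.preimage_mono Set.inter_subset_left)) _)
  have hac : μ ≪ μ.map f^[n] := Measure.AbsolutelyContinuous.mk fun B hB h0 => by
    rwa [Measure.map_apply hq.measurable hB, hW.measure_preimage_iterate_eq_zero_iff n hB] at h0
  have hcomm : Commute (h.compositionOperator p hp) U := hU.trans hU'.symm
  refine ContinuousLinearMap.opNorm_le_bound _ ENNReal.toReal_nonneg fun φ => ?_
  set η : Lp ℂ p μ := (U ^ n * lpIndicator μ p hA) φ
  have hTη : (h.compositionOperator p hp ^ n) η = lpIndicator μ p hA φ := by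
    change (h.compositionOperator p hp ^ n * (U ^ n * lpIndicator μ p hA)) φ = _
    rw [← mul_assoc, ← hcomm.mul_pow, hU, one_pow, one_mul]
  have hcomp : η ∘ f^[n] =ᵐ[μ] A.indicator φ :=
    (h.compositionOperator_pow_coeFn hp n η).symm.trans (hTη ▸ lpIndicator_coeFn hA φ)
  have hsupp : η =ᵐ[μ] (iterImage f n A).indicator η := by
    refine hac.ae_le (((f.measurableEmbedding_iterate n).ae_map_iff).2 ?_)
    filter_upwards [hcomp] with x hx
    by_cases hxA : x ∈ A
    · rw [Set.indicator_of_mem]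
      rwa [← Set.mem_preimage, hpre]
    · rw [Set.indicator_of_notMem]
      · rwa [Set.indicator_of_notMem hxA] at hx
      · rwa [← Set.mem_preimage, hpre]
  rw [Lp.norm_def, Lp.norm_def, ← ENNReal.toReal_mul]
  refine ENNReal.toReal_mono (ENNReal.mul_ne_top
    (ENNReal.rpow_ne_top_of_nonneg ENNReal.toReal_nonneg hc) (Lp.eLpNorm_ne_top φ)) ?_
  calc eLpNorm η p μ = eLpNorm η p (μ.restrict (iterImage f n A)) := by
        rw [eLpNorm_congr_ae hsupp, eLpNorm_indicator_eq_eLpNorm_restrict hD]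
    _ ≤ eLpNorm η p (c • μ.map f^[n]) := eLpNorm_mono_measure _ hle
    _ = c ^ (1 / p).toReal * eLpNorm (A.indicator φ) p μ := by
      rw [eLpNorm_smul_measure_of_ne_top hp, smul_eq_mul, eLpNorm_map_measure
        ((Lp.aestronglyMeasurable η).mono_ac hq.absolutelyContinuous) hq.aemeasurable,
        eLpNorm_congr_ae hcomp]
    _ ≤ c ^ (1 / p).toReal * eLpNorm φ p μ := mul_le_mul_right (eLpNorm_indicator_le _) _

end IsCompositionSystem

theorem summable_of_le_toReal_rpow {C r : ℝ≥0∞} (hr : r < 1) {a : ℝ} (ha : 0 < a)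
    {u : ℕ → ℝ} (hu : ∀ n, 0 ≤ u n)
    (h : ∀ᶠ n in atTop, u n ≤ ((C * r ^ n) ^ a).toReal) : Summable u := by
  have hq : (r ^ a).toReal < 1 := by
    simpa using ENNReal.toReal_strict_mono ENNReal.one_ne_top (ENNReal.rpow_lt_one hr ha)
  refine Summable.of_norm_bounded_eventually_nat
    ((summable_geometric_of_lt_one ENNReal.toReal_nonneg hq).mul_left (C ^ a).toReal)
    (h.mono fun n hn => ?_)
  rw [Real.norm_of_nonneg (hu n)]
  refine hn.trans_eq ?_
  rw [ENNReal.mul_rpow_of_nonneg _ _ ha.le, ENNReal.toReal_mul, ← ENNReal.rpow_natCast_mul,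
    mul_comm (n : ℝ), ENNReal.rpow_mul_natCast, ENNReal.toReal_pow]

/-- If the measures of the translates of `W` decay exponentially in the past of the indices in `S`
and in the future of the other indices, then the composition operator is strongly structurally
stable. -/
theorem stronglyStructurallyStable_of_exponential_decay (hp : p ≠ ∞)
    (hcomp : IsCompositionSystem μ f) (hdiss : IsDissipativeSystemOfBoundedDistortion μ f W)
    (hinv : IsUnit (hcomp.compositionOperator p hp)) (S : Set ℤ) {r s : ℝ≥0∞} (hr : r < 1)
    (hs : s < 1)
    (hpast : ∀ᶠ n : ℕ in atTop, ∀ k ∈ S,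
      μ (iterImage f (-n + k) W) ≤ r ^ n * μ (iterImage f k W))
    (hfuture : ∀ᶠ n : ℕ in atTop, ∀ k ∉ S,
      μ (iterImage f (n + k) W) ≤ s ^ n * μ (iterImage f k W)) :
    StronglyStructurallyStable (hcomp.compositionOperator p hp) := by
  obtain ⟨⟨T, U, hTU, hUT⟩, hT⟩ := hinv
  obtain rfl : T = hcomp.compositionOperator p hp := hT
  obtain ⟨C, hC, hmeas⟩ := hdiss.exists_measure_iterImage_le
  have ha : 0 < (1 / p).toReal := by
    refine ENNReal.toReal_pos (by simpa using hp) ?_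
    have : p ≠ 0 := (zero_lt_one.trans_le Fact.out).ne'
    simpa using this
  have hA : MeasurableSet (⋃ k ∈ S, iterImage f k W) :=
    .biUnion S.to_countable fun k _ => measurableSet_iterImage k hdiss.measurableSet
  have hAc : (⋃ k ∈ S, iterImage f k W)ᶜ ⊆ ⋃ k ∈ Sᶜ, iterImage f k W := fun x hx => by
    obtain ⟨k, hk⟩ := Set.mem_iUnion.1 (hdiss.iUnion_eq ▸ Set.mem_univ x)
    refine Set.mem_biUnion (fun hkS => hx (Set.mem_biUnion hkS hk)) hk
  refine stronglyStructurallyStable_of_summable (P := lpIndicator μ p hA) hTU hUT ?_ ?_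
  · refine summable_of_le_toReal_rpow (C := C) hr ha (fun _ => norm_nonneg _)
      (hpast.mono fun n hn => ?_)
    exact hcomp.norm_compositionOperator_pow_mul_lpIndicator_le hp n hA
      (ENNReal.mul_ne_top hC (ENNReal.pow_ne_top hr.ne_top)) (hmeas _ S _ hn)
  · rw [one_sub_lpIndicator]
    refine (summable_nat_add_iff (f := fun n => ‖U ^ n * lpIndicator μ p hA.compl‖) 1).2 ?_
    refine summable_of_le_toReal_rpow (C := C) hs ha (fun _ => norm_nonneg _)
      (hfuture.mono fun n hn => ?_)
    exact hcomp.norm_inverse_pow_mul_lpIndicator_le hdiss.toIsDissipativeSystem hp hTU hUT n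
      hA.compl (ENNReal.mul_ne_top hC (ENNReal.pow_ne_top hs.ne_top))
      fun B hB hBA => hmeas _ Sᶜ _ hn B hB (hBA.trans hAc)

end CompositionOperator

/-! ### From the growth conditions to geometric decay. -/

theorem exists_eventually_le_pow_mul_of_limsup_lt_one {ι : Type*} {a b : ℕ → ι → ℝ≥0∞}
    (hb : ∀ n i, b n i ≠ 0)
    (h : limsup (fun n : ℕ => ⨆ i, (a n i / b n i) ^ (1 / (n : ℝ))) atTop < 1) :
    ∃ r < 1, ∀ᶠ n : ℕ in atTop, ∀ i, a n i ≤ r ^ n * b n i := by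
  -- The maximum with `0` forces `r > 0`, so the denominator can be cleared even where `b n i` is
  -- infinite.
  obtain ⟨r, hr, hr1⟩ := exists_between (max_lt h zero_lt_one)
  refine ⟨r, hr1, ?_⟩
  have hr0 : r ≠ 0 := ((le_max_right _ _).trans_lt hr).ne'
  filter_upwards [eventually_lt_of_limsup_lt ((le_max_left _ _).trans_lt hr),
    eventually_gt_atTop 0] with n hn hn0 i
  have h₁ := (le_iSup (fun i => (a n i / b n i) ^ (1 / (n : ℝ))) i).trans hn.le
  rw [one_div, ENNReal.rpow_inv_le_iff (by exact_mod_cast hn0), ENNReal.rpow_natCast] at h₁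
  exact (ENNReal.div_le_iff_le_mul (.inl (hb n i)) (.inr (pow_ne_zero n hr0))).1 h₁

theorem exists_eventually_le_pow_mul_of_one_lt_liminf {ι : Type*} {a b : ℕ → ι → ℝ≥0∞}
    (h : 1 < liminf (fun n : ℕ => ⨅ i, (a n i / b n i) ^ (1 / (n : ℝ))) atTop) :
    ∃ r < 1, ∀ᶠ n : ℕ in atTop, ∀ i, b n i ≤ r ^ n * a n i := by
  obtain ⟨s, hs1, hs⟩ := exists_between h
  refine ⟨s⁻¹, ENNReal.inv_lt_one.2 hs1, ?_⟩
  filter_upwards [eventually_lt_of_lt_liminf hs, eventually_gt_atTop 0] with n hn hn0 i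
  have h₁ := hn.le.trans (iInf_le (fun i => (a n i / b n i) ^ (1 / (n : ℝ))) i)
  rw [one_div, ENNReal.le_rpow_inv_iff (by exact_mod_cast hn0), ENNReal.rpow_natCast] at h₁
  have h₂ := mul_le_mul_right (ENNReal.mul_le_of_le_div h₁) (s⁻¹ ^ n)
  rwa [← mul_assoc, ← mul_pow, ENNReal.inv_mul_cancel (zero_lt_one.trans hs1).ne' hs.ne_top,
    one_pow, one_mul] at h₂

theorem mainTheorem5 {X : Type*} [MeasurableSpace X] (μ : Measure X) (f : X ≃ᵐ X) (W : Set X)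
    (p : ℝ≥0∞) [Fact (1 ≤ p)] (hp : p ≠ ∞)
    (hcomp : IsCompositionSystem μ f)
    (hdiss : IsDissipativeSystemOfBoundedDistortion μ f W)
    (hinv : IsUnit (hcomp.compositionOperator p hp))
    (hcond : ConditionHC μ f W ∨ ConditionHD μ f W ∨ ConditionGH μ f W) :
    StronglyStructurallyStable (hcomp.compositionOperator p hp) := by
  have h0 := hdiss.measure_iterImage_ne_zero
  rcases hcond with h | h | ⟨h, h'⟩
  · obtain ⟨r, hr, H⟩ := exists_eventually_le_pow_mul_of_limsup_lt_one (fun n k => h0 _) h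
    refine stronglyStructurallyStable_of_exponential_decay hp hcomp hdiss hinv Set.univ hr
      zero_lt_one (H.mono fun n hn k _ => ?_) (.of_forall fun n k hk => (hk trivial).elim)
    -- The supremum runs over all of `ℤ`, so the index may be shifted by `-n`.
    simpa using hn (-n + k)
  · obtain ⟨r, hr, H⟩ := exists_eventually_le_pow_mul_of_one_lt_liminf h
    refine stronglyStructurallyStable_of_exponential_decay hp hcomp hdiss hinv ∅ zero_lt_one hr
      (.of_forall fun n k hk => hk.elim) (H.mono fun n hn k _ => ?_)
    simpa [add_comm] using hn k
  · obtain ⟨r, hr, H⟩ := exists_eventually_le_pow_mul_of_limsup_lt_one (fun n k => h0 _) h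
    obtain ⟨s, hs, H'⟩ := exists_eventually_le_pow_mul_of_one_lt_liminf h'
    -- `T` pushes supports towards `-∞` and its inverse towards `+∞`, so each half of `ℤ` is
    -- preserved in the time direction in which it must decay.
    refine stronglyStructurallyStable_of_exponential_decay hp hcomp hdiss hinv {k | k ≤ 0} hr hs
      (H.mono fun n hn k hk => ?_) (H'.mono fun n hn k hk => ?_)
    · simpa [sub_eq_neg_add] using hn ⟨k, hk⟩
    · simpa [add_comm] using hn ⟨k, (not_le.1 hk).le⟩
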